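/- Let $L>0$ and $\gamma\in\mathbb{R}$. A control is a continuous function $n:[0,L]\to\mathbb{C}$, and a trajectory for the control $n$ is a differentiable function $q:[0,L]\to\mathbb{C}$ of the real variable $z$ (one-sided derivatives at the end points) with $$q'(z)=i\gamma|q(z)|^2q(z)+n(z),\qquad 0\le z\le L. \tag{1}$$ For every control $\hat n$ and every initial state $x\in\mathbb{C}$, there is a unique trajectory $\hat q$ for $\hat n$ with $\hat q(0)=x$, and the system (1) is locally controllable along $\hat q$, that is: for every $\varepsilon>0$ there exists $\delta>0$ such that for all $(a,b)\in\mathbb{C}^2$ with $|\hat q(0)-a|<\delta$ and $|\hat q(L)-b|<\delta$ there exists a control $n$ with $|\hat n(z)-n(z)|\le\varepsilon$ for all $z\in[0,L]$ whose trajectory $q$ with $q(0)=a$ satisfies $q(L)=b$. -/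

import Mathlib

open Set

namespace PerSample

/-- The Kerr nonlinearity `f(q) = iγ|q|²q`. -/
noncomputable def kerr (γ : ℝ) (q : ℂ) : ℂ :=
  Complex.I * (γ : ℂ) * ((‖q‖ : ℂ) ^ 2) * q

/-- Admissible controls: continuous complex-valued functions on `[0, L]`. Values outside
`[0, L]` are irrelevant. -/
def IsControl (L : ℝ) (n : ℝ → ℂ) : Prop :=
  ContinuousOn n (Icc 0 L)

/-- `q` solves `q' = f(q) + n` on `[0, L]` (one-sided derivatives at the end points). The
derivative is that of a function of a real variable, i.e. it is taken component-wise. Values of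
`q` outside `[0, L]` are irrelevant. -/
def IsTrajectory (γ L : ℝ) (n q : ℝ → ℂ) : Prop :=
  ∀ z ∈ Icc (0 : ℝ) L, HasDerivWithinAt q (kerr γ (q z) + n z) (Icc 0 L) z

/-- The channel relation `b = N(a, n)`: the trajectory from `a` for the control `n` ends at `b`. -/
def Output (γ L : ℝ) (a : ℂ) (n : ℝ → ℂ) (b : ℂ) : Prop :=
  ∃ q : ℝ → ℂ, IsTrajectory γ L n q ∧ q 0 = a ∧ q L = b

/-- Local controllability of `q' = f(q) + n` on `[0, L]` along the trajectory `qhat` that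
belongs to the control `nhat`. -/
def LocallyControllableAlong (γ L : ℝ) (nhat qhat : ℝ → ℂ) : Prop :=
  ∀ ε : ℝ, 0 < ε → ∃ δ : ℝ, 0 < δ ∧ ∀ a b : ℂ,
    ‖qhat 0 - a‖ < δ → ‖qhat L - b‖ < δ →
      ∃ n : ℝ → ℂ, IsControl L n ∧ Output γ L a n b ∧
        ∀ z ∈ Icc (0 : ℝ) L, ‖nhat z - n z‖ ≤ ε

end PerSample

/-!
The nonlinearity `iγ|q|²q` is tangent to the circles about the origin, so it does not contribute to
the growth of `|q|`: if `|n| ≤ N`, then `(|q|²)' = 2 Re (q̄ n) ≤ |q|² + N²`, and hence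
`|q(z)|² ≤ e^L (|q(0)|² + N²)` on `[0, L]` (`norm_sq_le_of_hasDerivWithinAt_rotation`). The bound
does not depend on the rotation speed, so it survives multiplication of the nonlinearity by a smooth
real cutoff function. The equation with cutoff has a bounded, globally Lipschitz right-hand side, so
the Picard–Lindelöf theorem solves it on all of `[0, L]`; if the cutoff equals `1` on the ball given
by the bound, the solution never sees the cutoff and is a trajectory (`exists_isTrajectory`).
Uniqueness is Grönwall's inequality on a ball that contains both trajectories.

Controllability needs no fixed point argument, because the control enters the equation directly: any
differentiable curve `q` for which `n = q' - f(q)` is continuous is the trajectory of the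
control `n`. The reference trajectory is corrected by the affine function `p` that takes the
values `a - q̂(0)` at `0` and `b - q̂(L)` at `L`. The control for `q̂ + p` is
`n̂ + p' + f(q̂) - f(q̂ + p)`, which is uniformly close to `n̂` since `p` and `p'` are small and `f` is
Lipschitz on bounded sets (`locallyControllableAlong_of_isTrajectory`).
-/

namespace PerSample

theorem contDiff_kerr (γ : ℝ) : ContDiff ℝ 1 (kerr γ) := by
  have h : ContDiff ℝ 1 fun q : ℂ => ((‖q‖ ^ 2 : ℝ) : ℂ) :=
    Complex.ofRealCLM.contDiff.comp (contDiff_norm_sq ℝ)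
  have h' : ContDiff ℝ 1 fun q : ℂ => Complex.I * (γ : ℂ) * ((‖q‖ ^ 2 : ℝ) : ℂ) * q :=
    (contDiff_const.mul h).mul contDiff_id
  convert h' using 2 with q
  simp [kerr]

theorem exists_lipschitzOnWith_kerr (γ R : ℝ) :
    ∃ K, LipschitzOnWith K (kerr γ) (Metric.closedBall 0 R) :=
  (contDiff_kerr γ).contDiffOn.exists_lipschitzOnWith one_ne_zero (convex_closedBall 0 R)
    (isCompact_closedBall 0 R)

/-- The Kerr nonlinearity multiplied by a real cutoff function that is `1` on the ball of
radius `R` can be made bounded and globally Lipschitz. -/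
theorem exists_cutoff_kerr (γ : ℝ) {R : ℝ} (hR : 0 < R) :
    ∃ (φ : ℂ → ℝ) (K C : NNReal), (∀ q, ‖q‖ ≤ R → φ q = 1) ∧
      LipschitzWith K (fun q => φ q • kerr γ q) ∧ ∀ q, ‖φ q • kerr γ q‖ ≤ C := by
  let φ : ContDiffBump (0 : ℂ) := ⟨R, R + 1, hR, by linarith⟩
  have hsm : ContDiff ℝ 1 (fun q => φ q • kerr γ q) := φ.contDiff.smul (contDiff_kerr γ)
  have hcs : HasCompactSupport (fun q => φ q • kerr γ q) := φ.hasCompactSupport.smul_right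
  obtain ⟨K, hK⟩ := hsm.lipschitzWith_of_hasCompactSupport hcs one_ne_zero
  obtain ⟨C, hC⟩ := hcs.exists_bound_of_continuous hsm.continuous
  refine ⟨φ, K, C.toNNReal, fun q hq => φ.one_of_mem_closedBall (by simpa using hq), hK,
    fun q => (hC q).trans (Real.le_coe_toNNReal C)⟩

/-- A solution of `q' = iω(z)q + n` with real `ω` is bounded in terms of `q(0)` and `sup |n|` only:
the rotation term is orthogonal to `q`. -/
theorem norm_sq_le_of_hasDerivWithinAt_rotation {L N : ℝ} {n q : ℝ → ℂ} {ω : ℝ → ℝ}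
    (hn : ∀ z ∈ Icc (0 : ℝ) L, ‖n z‖ ≤ N)
    (hq : ∀ z ∈ Icc (0 : ℝ) L,
      HasDerivWithinAt q (Complex.I * (ω z : ℂ) * q z + n z) (Icc 0 L) z)
    {z : ℝ} (hz : z ∈ Icc (0 : ℝ) L) :
    ‖q z‖ ^ 2 ≤ Real.exp L * (‖q 0‖ ^ 2 + N ^ 2) := by
  have hder : ∀ t ∈ Icc (0 : ℝ) L,
      HasDerivWithinAt (fun t => Real.exp (-t) * (‖q t‖ ^ 2 + N ^ 2))
        (Real.exp (-t) * (2 * inner ℝ (q t) (n t) - ‖q t‖ ^ 2 - N ^ 2)) (Icc 0 L) t := by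
    intro t ht
    have h1 : HasDerivWithinAt (fun t : ℝ => Real.exp (-t)) (-Real.exp (-t)) (Icc 0 L) t := by
      simpa using (hasDerivAt_neg t).exp.hasDerivWithinAt
    have h2 := (hq t ht).norm_sq.add_const (N ^ 2)
    have h3 : inner ℝ (q t) (Complex.I * (ω t : ℂ) * q t + n t) = inner ℝ (q t) (n t) := by
      rw [inner_add_right]
      simp only [Complex.inner, add_eq_right]
      simp
      ring
    rw [h3] at h2
    exact (h1.mul h2).congr_deriv (by ring)
  have hanti : AntitoneOn (fun t => Real.exp (-t) * (‖q t‖ ^ 2 + N ^ 2)) (Icc 0 L) := by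
    refine antitoneOn_of_hasDerivWithinAt_nonpos (convex_Icc 0 L)
      (fun t ht => (hder t ht).continuousWithinAt)
      (fun t ht => (hder t (interior_subset ht)).mono interior_subset) fun t ht => ?_
    have h1 := real_inner_le_norm (q t) (n t)
    have h2 := hn t (interior_subset ht)
    refine mul_nonpos_of_nonneg_of_nonpos (Real.exp_pos _).le ?_
    nlinarith [sq_nonneg (‖q t‖ - N), mul_le_mul_of_nonneg_left h2 (norm_nonneg (q t))]
  have h0 := hanti ⟨le_rfl, hz.1.trans hz.2⟩ hz hz.1
  simp only [neg_zero, Real.exp_zero, one_mul] at h0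
  calc ‖q z‖ ^ 2 ≤ ‖q z‖ ^ 2 + N ^ 2 := by nlinarith [sq_nonneg N]
    _ = Real.exp z * (Real.exp (-z) * (‖q z‖ ^ 2 + N ^ 2)) := by
        rw [← mul_assoc, ← Real.exp_add]; simp
    _ ≤ Real.exp z * (‖q 0‖ ^ 2 + N ^ 2) := by gcongr
    _ ≤ Real.exp L * (‖q 0‖ ^ 2 + N ^ 2) := by gcongr; exact hz.2

theorem IsTrajectory.continuousOn {γ L : ℝ} {n q : ℝ → ℂ} (h : IsTrajectory γ L n q) :
    ContinuousOn q (Icc 0 L) :=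
  fun z hz => (h z hz).continuousWithinAt

theorem exists_isTrajectory (γ : ℝ) {L : ℝ} (hL : 0 < L) {n : ℝ → ℂ} (hn : IsControl L n)
    (x : ℂ) : ∃ q : ℝ → ℂ, IsTrajectory γ L n q ∧ q 0 = x := by
  obtain ⟨N', hN'⟩ := isCompact_Icc.exists_bound_of_continuousOn hn
  obtain ⟨N, hN⟩ : ∃ N : NNReal, ∀ z ∈ Icc (0 : ℝ) L, ‖n z‖ ≤ N :=
    ⟨N'.toNNReal, fun z hz => (hN' z hz).trans (Real.le_coe_toNNReal N')⟩
  set R : ℝ := Real.sqrt (Real.exp L * (‖x‖ ^ 2 + (N : ℝ) ^ 2))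
  -- `R` bounds the solution; `R + 1` is used because the cutoff needs a positive radius.
  obtain ⟨φ, K, C, hφ, hK, hC⟩ :=
    exists_cutoff_kerr γ (R := R + 1) (by positivity)
  -- The right-hand side is bounded by `C + N` everywhere, so a ball of radius `(C + N) L` cannot
  -- be left in time `L`.
  have hPL : IsPicardLindelof (fun z q => φ q • kerr γ q + n z)
      (⟨0, le_rfl, hL.le⟩ : Icc (0 : ℝ) L) x ((C + N) * L.toNNReal) 0 (C + N) K := by
    refine ⟨fun t _ => ?_, fun q _ => continuousOn_const.add hn, fun t ht q _ => ?_, ?_⟩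
    · refine LipschitzWith.lipschitzOnWith (LipschitzWith.of_dist_le_mul fun p q => ?_)
      simpa using hK.dist_le_mul p q
    · simpa using (norm_add_le _ _).trans (add_le_add (hC q) (hN t ht))
    · simp [hL.le]
  obtain ⟨q, hq0, hq⟩ := hPL.exists_eq_forall_mem_Icc_hasDerivWithinAt₀
  refine ⟨q, fun z hz => ?_, hq0⟩
  replace hq0 : q 0 = x := hq0
  have hbound : ‖q z‖ ^ 2 ≤ Real.exp L * (‖q 0‖ ^ 2 + (N : ℝ) ^ 2) := by
    refine norm_sq_le_of_hasDerivWithinAt_rotation (ω := fun t => φ (q t) * (γ * ‖q t‖ ^ 2)) hN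
      (fun t ht => ?_) hz
    refine (hq t ht).congr_deriv ?_
    simp only [kerr, Complex.real_smul, Complex.ofReal_mul, Complex.ofReal_pow]
    ring
  have hle : ‖q z‖ ≤ R + 1 := by
    rw [hq0] at hbound
    linarith [Real.le_sqrt_of_sq_le hbound]
  simpa [hφ _ hle] using hq z hz

theorem IsTrajectory.eqOn {γ L : ℝ} {n p q : ℝ → ℂ} (hp : IsTrajectory γ L n p)
    (hq : IsTrajectory γ L n q) (h0 : p 0 = q 0) : EqOn p q (Icc 0 L) := by
  obtain ⟨A, hA⟩ := isCompact_Icc.exists_bound_of_continuousOn hp.continuousOn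
  obtain ⟨B, hB⟩ := isCompact_Icc.exists_bound_of_continuousOn hq.continuousOn
  obtain ⟨K, hK⟩ := exists_lipschitzOnWith_kerr γ (max A B)
  refine ODE_solution_unique_of_mem_Icc_right (v := fun z w => kerr γ w + n z)
    (s := fun _ => Metric.closedBall 0 (max A B)) (K := K) (fun t _ => ?_) hp.continuousOn
    (fun t ht => ?_) (fun t ht => ?_) hq.continuousOn (fun t ht => ?_) (fun t ht => ?_) h0
  · refine LipschitzOnWith.of_dist_le_mul fun u hu w hw => ?_
    simpa using hK.dist_le_mul u hu w hw
  · exact (hp t (Ico_subset_Icc_self ht)).mono_of_mem_nhdsWithin (Icc_mem_nhdsGE_of_mem ht)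
  · simpa using Or.inl (hA t (Ico_subset_Icc_self ht))
  · exact (hq t (Ico_subset_Icc_self ht)).mono_of_mem_nhdsWithin (Icc_mem_nhdsGE_of_mem ht)
  · simpa using Or.inr (hB t (Ico_subset_Icc_self ht))

theorem locallyControllableAlong_of_isTrajectory {γ L : ℝ} (hL : 0 < L) {nhat qhat : ℝ → ℂ}
    (hn : IsControl L nhat) (hq : IsTrajectory γ L nhat qhat) :
    LocallyControllableAlong γ L nhat qhat := by
  intro ε hε
  obtain ⟨M, hM⟩ := isCompact_Icc.exists_bound_of_continuousOn hq.continuousOn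
  obtain ⟨K, hK⟩ := exists_lipschitzOnWith_kerr γ (M + 1)
  -- `δ ≤ 1` keeps the corrected curve in the ball of radius `M + 1`; the correction changes the
  -- control by at most `2δ/L` through `p'` and by at most `Kδ` through the nonlinearity.
  have hpos : 0 < (K : ℝ) + 2 / L := by positivity
  refine ⟨min 1 (ε / (K + 2 / L)), by positivity, fun a b ha hb => ?_⟩
  set δ := min 1 (ε / (K + 2 / L))
  have hδ1 : δ ≤ 1 := min_le_left _ _
  have hδε : (K + 2 / L) * δ ≤ ε := by
    have := (le_div_iff₀ hpos).1 (min_le_right 1 (ε / (K + 2 / L)))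
    linarith
  set u := a - qhat 0 with hu
  set v := b - qhat L with hv
  have hu' : ‖u‖ ≤ δ := by rw [hu, norm_sub_rev]; exact ha.le
  have hv' : ‖v‖ ≤ δ := by rw [hv, norm_sub_rev]; exact hb.le
  set p : ℝ → ℂ := fun z => u + (z / L) • (v - u) with hp
  have hpder : ∀ z, HasDerivAt p ((1 / L) • (v - u)) z := fun z =>
    (((hasDerivAt_id z).div_const L).smul_const (v - u)).const_add u
  have hpn : ∀ z ∈ Icc (0 : ℝ) L, ‖p z‖ ≤ δ := by
    intro z hz
    have hmem := (convex_closedBall (0 : ℂ) δ).add_smul_sub_mem (x := u) (y := v) (t := z / L)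
      (by simpa using hu') (by simpa using hv')
      ⟨div_nonneg hz.1 hL.le, (div_le_one hL).2 hz.2⟩
    exact mem_closedBall_zero_iff.1 hmem
  have hqpc : ContinuousOn (fun z => qhat z + p z) (Icc 0 L) :=
    hq.continuousOn.add fun z _ => (hpder z).continuousAt.continuousWithinAt
  have hkc : Continuous (kerr γ) := (contDiff_kerr γ).continuous
  refine ⟨fun z => nhat z + (1 / L) • (v - u) + (kerr γ (qhat z) - kerr γ (qhat z + p z)),
    ?_, ⟨fun z => qhat z + p z, fun z hz => ?_, ?_, ?_⟩, fun z hz => ?_⟩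
  · exact (hn.add continuousOn_const).add
      ((hkc.comp_continuousOn hq.continuousOn).sub (hkc.comp_continuousOn hqpc))
  · exact ((hq z hz).add (hpder z).hasDerivWithinAt).congr_deriv (by ring)
  · simp [hp, hu]
  · simp only [hp, hv, div_self hL.ne', one_smul]
    ring
  · have h1 : ‖(1 / L) • (v - u)‖ ≤ 2 / L * δ := by
      rw [norm_smul, Real.norm_of_nonneg (by positivity)]
      calc 1 / L * ‖v - u‖ ≤ 1 / L * (δ + δ) := by
            gcongr
            exact (norm_sub_le _ _).trans (add_le_add hv' hu')
        _ = 2 / L * δ := by ring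
    have h2 : ‖kerr γ (qhat z + p z) - kerr γ (qhat z)‖ ≤ K * δ := by
      have hz1 : qhat z ∈ Metric.closedBall (0 : ℂ) (M + 1) := by
        simpa using (hM z hz).trans (by linarith)
      have hz2 : qhat z + p z ∈ Metric.closedBall (0 : ℂ) (M + 1) := by
        simpa using (norm_add_le _ _).trans (add_le_add (hM z hz) ((hpn z hz).trans hδ1))
      have h := hK.dist_le_mul _ hz2 _ hz1
      rw [dist_eq_norm, dist_eq_norm, add_sub_cancel_left] at h
      exact h.trans (by gcongr; exact hpn z hz)
    calc ‖nhat z - (nhat z + (1 / L) • (v - u) + (kerr γ (qhat z) - kerr γ (qhat z + p z)))‖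
        = ‖(kerr γ (qhat z + p z) - kerr γ (qhat z)) - (1 / L) • (v - u)‖ := by congr 1; ring
      _ ≤ K * δ + 2 / L * δ := (norm_sub_le _ _).trans (add_le_add h2 h1)
      _ ≤ ε := by linarith

end PerSample

theorem mainTheorem8 (γ L : ℝ) (hL : 0 < L) (nhat : ℝ → ℂ)
    (hn : PerSample.IsControl L nhat) (x : ℂ) :
    ∃ qhat : ℝ → ℂ,
      (PerSample.IsTrajectory γ L nhat qhat ∧ qhat 0 = x) ∧
      (∀ q : ℝ → ℂ, PerSample.IsTrajectory γ L nhat q → q 0 = x →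
        Set.EqOn q qhat (Set.Icc 0 L)) ∧
      PerSample.LocallyControllableAlong γ L nhat qhat := by
  obtain ⟨qhat, hq, hx⟩ := PerSample.exists_isTrajectory γ hL hn x
  exact ⟨qhat, ⟨hq, hx⟩, fun q hq' hx' => hq'.eqOn hq (hx'.trans hx.symm),
    PerSample.locallyControllableAlong_of_isTrajectory hL hn hq⟩
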